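/- Let $\mathcal{G}$ be a Grothendieck category and let $n \geq 1$. An object $F$ of $\mathcal{G}$ is of type $\mathrm{FP}_n$ if the functor $\operatorname{Ext}^i(F,-)\colon \mathcal{G}\to\mathsf{Ab}$ preserves direct limits for every $0\le i\le n-1$; write $\mathrm{FP}_n(\mathcal{G})$ for the class of these objects. The category $\mathcal{G}$ is locally type $\mathrm{FP}_n$ if it has a generating set consisting of objects of type $\mathrm{FP}_n$, and $n$-hereditary if it is locally type $\mathrm{FP}_n$ and $\mathrm{pd}(\mathrm{FP}_n(\mathcal{G})) := \sup\{\mathrm{pd}(F) \mid F\in\mathrm{FP}_n(\mathcal{G})\}\le 1$. Let $$\mathcal{I}_n(\mathcal{G}) := \{M\in\mathcal{G} \mid \operatorname{Ext}^1(F,M)=0 \text{ for all } F\in \mathrm{FP}_n(\mathcal{G})\}$$ be the class of $\mathrm{FP}_n$-injective objects. A class $\mathcal{T}$ of objects is a torsion class if there is a class $\mathcal{F}$ such that $\mathcal{F}=\{M \mid \operatorname{Hom}(T,M)=0 \text{ for all } T\in\mathcal{T}\}$ and $\mathcal{T}=\{M \mid \operatorname{Hom}(M,F)=0\text{ for all }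 F\in\mathcal{F}\}$. For an object $T$, let $\mathrm{Gen}(T)$ be the class of all objects $M$ admitting an epimorphism $\bigoplus_{i\in I}T\to M$ for some set $I$; the object $T$ is $1$-tilting if $\mathrm{Gen}(T)=\{M \mid \operatorname{Ext}^1(T,M)=0\}$, and a $1$-tilting class is a class of the form $\mathrm{Gen}(T)$ with $T$ a $1$-tilting object. Then the following are equivalent: 1. $\mathcal{G}$ is $n$-hereditary. 2. $\mathcal{G}$ is locally type $\mathrm{FP}_n$, and $\mathcal{I}_n(\mathcal{G})$ is a torsion class. 3. $\mathcal{G}$ is locally type $\mathrm{FP}_n$, and $\mathcal{I}_n(\mathcal{G})$ is a $1$-tilting class. -/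

import Mathlib

open CategoryTheory CategoryTheory.Limits CategoryTheory.Abelian

universe v u

namespace GrothendieckFP

section

variable {C : Type u} [Category.{v} C] [Abelian C]

/-- An object is finitely generated if, whenever it is the supremum of a (nonempty) directed
family of subobjects, it already belongs to that family. -/
def IsFinitelyGenerated (X : C) : Prop :=
  ∀ s : Set (Subobject X), s.Nonempty → DirectedOn (· ≤ ·) s → IsLUB s ⊤ → ⊤ ∈ s

/-- `(T, F)` is a torsion pair: `F` consists of the objects receiving no nonzero morphism from an
object in `T`, and `T` of the objects with no nonzero morphism to an object in `F`. -/
structure IsTorsionPair (T F : ObjectProperty C) : Prop where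
  torsionFree_eq : F = T.rightOrthogonal
  torsion_eq : T = F.leftOrthogonal

/-- A torsion class is the first component of some torsion pair. -/
def IsTorsionClass (T : ObjectProperty C) : Prop :=
  ∃ F : ObjectProperty C, IsTorsionPair T F

/-- The supremum of the projective dimensions of the objects in a class. -/
noncomputable def classProjectiveDimension (P : ObjectProperty C) : WithBot ℕ∞ :=
  ⨆ (X : C) (_ : P X), projectiveDimension X

end

section

variable {C : Type u} [Category.{v} C] [Abelian C] [IsGrothendieckAbelian.{v} C]

/-- Objects of type `FP_n`: for `n ≥ 1`, the functors `Ext^i(X, -)` with `0 ≤ i ≤ n - 1` preserve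
direct limits; objects of type `FP_0` are the finitely generated objects. -/
def isFP : ℕ → ObjectProperty C
  | 0 => fun X => IsFinitelyGenerated X
  | n + 1 => fun X => ∀ i : ℕ, i ≤ n →
      PreservesFilteredColimitsOfSize.{v, v} (extFunctorObj X i)

/-- The class `P^{⊥₁}` of the objects `M` with `Ext¹(X, M) = 0` for all `X` in `P`. -/
def rightExtOrthogonal (P : ObjectProperty C) : ObjectProperty C :=
  fun M => ∀ X : C, P X → Subsingleton (Ext.{v} X M 1)

/-- The class of `FP_n`-injective objects. -/
def fpInjective (n : ℕ) : ObjectProperty C :=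
  rightExtOrthogonal (isFP n)

/-- The class `Gen(T)` of the objects which are quotients of a coproduct of copies of `T`. -/
def gen (T : C) : ObjectProperty C :=
  fun M => ∃ (I : Type v) (f : (∐ fun _ : I => T) ⟶ M), Epi f

/-- `T` is `1`-tilting if `Gen(T) = T^{⊥₁}`. -/
def IsOneTilting (T : C) : Prop :=
  gen T = rightExtOrthogonal (ObjectProperty.singleton T)

/-- A `1`-tilting class is a class of the form `Gen(T)` with `T` a `1`-tilting object. -/
def IsOneTiltingClass (P : ObjectProperty C) : Prop :=
  ∃ T : C, IsOneTilting T ∧ P = gen T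

variable (C)

/-- `C` is locally type `FP_n` if it has a (small) generating set of objects of type `FP_n`. -/
def IsLocallyTypeFP (n : ℕ) : Prop :=
  ∃ (I : Type v) (G : I → C), (ObjectProperty.ofObj G).IsSeparating ∧ ∀ i, isFP n (G i)

/-- `C` is `n`-hereditary if it is locally type `FP_n` and every object of type `FP_n` has
projective dimension at most `1`. -/
structure IsHereditaryFP (n : ℕ) : Prop where
  locallyTypeFP : IsLocallyTypeFP C n
  pd_le_one : classProjectiveDimension (isFP n : ObjectProperty C) ≤ 1

end

end GrothendieckFP

/-! Everything turns on closure of the `FP_n`-injectives under quotients. If `pd ≤ 1`, it holds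
because `Ext²(F, -)` vanishes; conversely it makes `E/M` `FP_n`-injective for `M` inside an
injective `E`, and dimension shifting gives `Ext²(F, M) = 0`. Torsion classes and classes `Gen(T)`
are closed under quotients, so 2 and 3 imply 1.

For 1 ⇒ 2, closure under extensions is formal, and coproducts are handled by
`subsingleton_ext_colimit`. For 1 ⇒ 3, countably many universal extensions embed a generator `G`
into an `FP_n`-injective `T` with `Ext¹(T/G, M) = 0` for all `FP_n`-injective `M`; then `T ⊞ T/G` is
tilting. Carrying an injective ambient object along the chain turns the vanishing of `Ext¹` at the
colimit into a lifting problem. -/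

namespace GrothendieckFP

/-! ### Short exact sequences and finite coproducts -/

section

variable {C : Type u} [Category.{v} C] [Abelian C]

lemma shortExact_cokernel {X Y : C} (f : X ⟶ Y) [Mono f] :
    (ShortComplex.mk f (cokernel.π f) (cokernel.condition f)).ShortExact :=
  { exact := ShortComplex.exact_cokernel f }

lemma shortExact_kernel {X Y : C} (f : X ⟶ Y) [Epi f] :
    (ShortComplex.mk (kernel.ι f) f (kernel.condition f)).ShortExact :=
  { exact := ShortComplex.exact_kernel f }

lemma id_sigma_eq_sum {ι : Type*} [Fintype ι] [DecidableEq ι] (M : ι → C) :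
    𝟙 (∐ M) = ∑ i, Sigma.π M i ≫ Sigma.ι M i := by
  refine Sigma.hom_ext _ _ fun j => ?_
  rw [Preadditive.comp_sum, Finset.sum_eq_single j]
  · simp
  · intro i _ hij
    rw [Sigma.ι_π_of_ne_assoc _ hij.symm, zero_comp]
  · simp

lemma eq_zero_of_comp_sigma_π {ι : Type*} [Finite ι] [DecidableEq ι] (M : ι → C) {X : C}
    (f : X ⟶ ∐ M) (h : ∀ i, f ≫ Sigma.π M i = 0) : f = 0 := by
  have := Fintype.ofFinite ι
  rw [← Category.comp_id f, id_sigma_eq_sum, Preadditive.comp_sum]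
  exact Finset.sum_eq_zero fun i _ => by rw [reassoc_of% h i, zero_comp]

lemma shortExact_pullback {S : ShortComplex C} (hS : S.ShortExact) {Z : C} (g : Z ⟶ S.X₃) :
    (ShortComplex.mk (pullback.lift (f := S.g) (g := g) S.f 0
      (by rw [S.zero, zero_comp])) (pullback.snd S.g g) (pullback.lift_snd _ _ _)).ShortExact := by
  have := hS.mono_f
  have := hS.epi_g
  have : Mono (pullback.lift (f := S.g) (g := g) S.f 0 (by rw [S.zero, zero_comp])) :=
    mono_of_mono_fac (pullback.lift_fst _ _ _)
  refine { exact := ShortComplex.exact_of_f_is_kernel _ (KernelFork.IsLimit.ofι' _ _ fun k hk =>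
    ⟨hS.fIsKernel.lift (KernelFork.ofι (k ≫ pullback.fst S.g g) ?_), ?_⟩) }
  · dsimp at hk
    rw [Category.assoc, pullback.condition, reassoc_of% hk, zero_comp]
  · refine pullback.hom_ext ?_ ?_
    · rw [Category.assoc, pullback.lift_fst]
      exact hS.fIsKernel.fac _ WalkingParallelPair.zero
    · rw [Category.assoc, pullback.lift_snd, comp_zero]
      exact hk.symm

end

/-! ### Vanishing of Ext -/

section ExtOne

universe w

variable {C : Type u} [Category.{v} C] [Abelian C] [HasExt.{w} C]

lemma exists_lift_of_subsingleton_ext {S : ShortComplex C} (hS : S.ShortExact) {X : C}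
    (h : Subsingleton (Ext.{w} X S.X₁ 1)) (f : X ⟶ S.X₃) : ∃ g : X ⟶ S.X₂, g ≫ S.g = f := by
  obtain ⟨x, hx⟩ := Ext.covariant_sequence_exact₃ X hS (Ext.mk₀ f) (zero_add 1)
    (Subsingleton.elim _ _)
  obtain ⟨g, rfl⟩ := (Ext.mk₀_bijective _ _).2 x
  exact ⟨g, (Ext.mk₀_bijective _ _).1 (by rw [← hx, Ext.mk₀_comp_mk₀])⟩

lemma subsingleton_ext_of_exists_lift {S : ShortComplex C} (hS : S.ShortExact) {X : C}
    (h₂ : Subsingleton (Ext.{w} X S.X₂ 1))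
    (h : ∀ f : X ⟶ S.X₃, ∃ g : X ⟶ S.X₂, g ≫ S.g = f) : Subsingleton (Ext.{w} X S.X₁ 1) := by
  refine subsingleton_of_forall_eq 0 fun x => ?_
  obtain ⟨y, rfl⟩ := Ext.covariant_sequence_exact₁ X hS x (Subsingleton.elim _ _) (zero_add 1)
  obtain ⟨f, rfl⟩ := (Ext.mk₀_bijective _ _).2 y
  obtain ⟨g, rfl⟩ := h f
  rw [← Ext.mk₀_comp_mk₀, Ext.comp_assoc_of_second_deg_zero, hS.comp_extClass, Ext.comp_zero]

lemma exists_extension_of_subsingleton_ext {S : ShortComplex C} (hS : S.ShortExact) {Y : C}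
    (h : Subsingleton (Ext.{w} S.X₃ Y 1)) (f : S.X₁ ⟶ Y) : ∃ g : S.X₂ ⟶ Y, S.f ≫ g = f := by
  obtain ⟨x, hx⟩ := Ext.contravariant_sequence_exact₁ hS Y (Ext.mk₀ f) (add_zero 1)
    (Subsingleton.elim _ _)
  obtain ⟨g, rfl⟩ := (Ext.mk₀_bijective _ _).2 x
  exact ⟨g, (Ext.mk₀_bijective _ _).1 (by rw [← hx, Ext.mk₀_comp_mk₀])⟩

lemma subsingleton_ext_extension_right {S : ShortComplex C} (hS : S.ShortExact) {X : C} {n : ℕ}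
    (h₁ : Subsingleton (Ext.{w} X S.X₁ n)) (h₃ : Subsingleton (Ext.{w} X S.X₃ n)) :
    Subsingleton (Ext.{w} X S.X₂ n) := by
  refine subsingleton_of_forall_eq 0 fun x => ?_
  obtain ⟨y, rfl⟩ := Ext.covariant_sequence_exact₂ X hS x (Subsingleton.elim _ _)
  rw [Subsingleton.elim y 0, Ext.zero_comp]

lemma subsingleton_ext_extension_left {S : ShortComplex C} (hS : S.ShortExact) {Y : C} {n : ℕ}
    (h₁ : Subsingleton (Ext.{w} S.X₁ Y n)) (h₃ : Subsingleton (Ext.{w} S.X₃ Y n)) :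
    Subsingleton (Ext.{w} S.X₂ Y n) := by
  refine subsingleton_of_forall_eq 0 fun x => ?_
  obtain ⟨y, rfl⟩ := Ext.contravariant_sequence_exact₂ hS Y x (Subsingleton.elim _ _)
  rw [Subsingleton.elim y 0, Ext.comp_zero]

lemma subsingleton_ext_quotient {S : ShortComplex C} (hS : S.ShortExact) {X : C} {n : ℕ}
    (h₂ : Subsingleton (Ext.{w} X S.X₂ n)) (h₁ : Subsingleton (Ext.{w} X S.X₁ (n + 1))) :
    Subsingleton (Ext.{w} X S.X₃ n) := by
  refine subsingleton_of_forall_eq 0 fun x => ?_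
  obtain ⟨y, rfl⟩ := Ext.covariant_sequence_exact₃ X hS x rfl (Subsingleton.elim _ _)
  rw [Subsingleton.elim y 0, Ext.zero_comp]

lemma subsingleton_ext_succ {S : ShortComplex C} (hS : S.ShortExact) {X : C} {n : ℕ}
    (h₃ : Subsingleton (Ext.{w} X S.X₃ n)) (h₂ : Subsingleton (Ext.{w} X S.X₂ (n + 1))) :
    Subsingleton (Ext.{w} X S.X₁ (n + 1)) := by
  refine subsingleton_of_forall_eq 0 fun x => ?_
  obtain ⟨y, rfl⟩ := Ext.covariant_sequence_exact₁ X hS x (Subsingleton.elim _ _) rfl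
  rw [Subsingleton.elim y 0, Ext.zero_comp]

lemma subsingleton_ext_finite_coproduct {ι : Type*} [Finite ι] (M : ι → C) {X : C} {n : ℕ}
    (h : ∀ i, Subsingleton (Ext.{w} X (M i) n)) : Subsingleton (Ext.{w} X (∐ M) n) := by
  classical
  have := Fintype.ofFinite ι
  refine subsingleton_of_forall_eq 0 fun x => ?_
  rw [← x.comp_mk₀_id, id_sigma_eq_sum, Ext.mk₀_sum, Ext.comp_sum]
  refine Finset.sum_eq_zero fun i _ => ?_
  have := h i
  rw [← Ext.mk₀_comp_mk₀, ← Ext.comp_assoc_of_second_deg_zero,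
    Subsingleton.elim (x.comp (Ext.mk₀ (Sigma.π M i)) (add_zero n)) 0, Ext.zero_comp]

/-- Embedding `Y` in an injective turns vanishing into a lifting problem, solved on each summand;
coproducts need not be exact. -/
lemma subsingleton_ext_coproduct [EnoughInjectives C] {ι : Type*} (X : ι → C) [HasCoproduct X]
    {Y : C} (h : ∀ i, Subsingleton (Ext.{w} (X i) Y 1)) : Subsingleton (Ext.{w} (∐ X) Y 1) := by
  refine subsingleton_ext_of_exists_lift (shortExact_cokernel (Injective.ι Y))
    (Ext.subsingleton_of_injective _ _ _) fun f => ?_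
  choose g hg using fun i => exists_lift_of_subsingleton_ext
    (shortExact_cokernel (Injective.ι Y)) (h i) (Sigma.ι X i ≫ f)
  exact ⟨Sigma.desc g, Sigma.hom_ext _ _ fun i => by simpa using hg i⟩

end ExtOne

/-! ### Ext and colimits -/

section FilteredColimits

universe w w' w''

variable {C : Type u} [Category.{v} C] [Abelian C] [HasExt.{w} C]
  {J : Type w'} [Category.{w''} J]

lemma exists_factorization_of_isColimit {F : C} [PreservesColimitsOfShape J (extFunctorObj F 0)]
    [PreservesColimitsOfShape J (forget AddCommGrpCat.{w})]
    {D : J ⥤ C} {c : Cocone D} (hc : IsColimit c) (f : F ⟶ c.pt) :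
    ∃ (j : J) (g : F ⟶ D.obj j), g ≫ c.ι.app j = f := by
  obtain ⟨j, y, hy⟩ := Concrete.isColimit_exists_rep _
    (isColimitOfPreserves (extFunctorObj.{w} F 0) hc) (Ext.mk₀ f)
  obtain ⟨g, rfl⟩ := (Ext.mk₀_bijective _ _).2 y
  exact ⟨j, g, (Ext.mk₀_bijective _ _).1 (by rw [← hy, ← Ext.mk₀_comp_mk₀]; rfl)⟩

/-- A map from `F` to the colimit of `S.X₃` factors through a stage, where it lifts after a
transition. Only `Hom(F, -)` must preserve the colimit, so the case `n = 1` is covered. -/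
lemma subsingleton_ext_colimit [HasColimitsOfShape J C] [HasExactColimitsOfShape J C]
    {F : C} [PreservesColimitsOfShape J (extFunctorObj F 0)]
    [PreservesColimitsOfShape J (forget AddCommGrpCat.{w})]
    {S : ShortComplex (J ⥤ C)} (hS : S.ShortExact)
    {c₁ : Cocone S.X₁} (hc₁ : IsColimit c₁) {c₂ : Cocone S.X₂} (hc₂ : IsColimit c₂)
    (h₂ : Subsingleton (Ext.{w} F c₂.pt 1))
    (h : ∀ (j : J) (f : F ⟶ S.X₃.obj j), ∃ (k : J) (a : j ⟶ k) (g : F ⟶ S.X₂.obj k),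
      g ≫ S.g.app k = f ≫ S.X₃.map a) :
    Subsingleton (Ext.{w} F c₁.pt 1) := by
  let c₃ := colimit.cocone S.X₃
  let p : c₁.pt ⟶ c₂.pt := hc₁.desc ((Cocone.precompose S.f).obj c₂)
  let q : c₂.pt ⟶ c₃.pt := hc₂.desc ((Cocone.precompose S.g).obj c₃)
  have hp (j) : c₁.ι.app j ≫ p = S.f.app j ≫ c₂.ι.app j := by simp [p]
  have hq (j) : c₂.ι.app j ≫ q = S.g.app j ≫ c₃.ι.app j := by simp [q]
  have := hS.mono_f
  have := hS.epi_g
  have : (colim.mapShortComplex S hc₁ c₂ c₃ p q hp hq).ShortExact :=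
    { exact := colim.exact_mapShortComplex hS.exact hc₁ hc₂ (colimit.isColimit _) p q hp hq
      mono_f := colim.map_mono' S.f hc₁ hc₂ p hp
      epi_g := colim.map_epi' S.g c₂ (colimit.isColimit _) q hq }
  refine subsingleton_ext_of_exists_lift this h₂ fun (f : F ⟶ c₃.pt) => ?_
  obtain ⟨j, f', rfl⟩ := exists_factorization_of_isColimit (colimit.isColimit _) f
  obtain ⟨k, a, g, hg⟩ := h j f'
  refine ⟨g ≫ c₂.ι.app k, ?_⟩
  change (g ≫ c₂.ι.app k) ≫ q = _
  rw [Category.assoc, hq, reassoc_of% hg, c₃.w]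

end FilteredColimits

/-! ### Torsion classes and projective dimension -/

section

variable {C : Type u} [Category.{v} C] [Abelian C]

lemma IsTorsionClass.of_epi {T : ObjectProperty C} (hT : IsTorsionClass T) {X Y : C} (f : X ⟶ Y)
    [Epi f] (hX : T X) : T Y := by
  obtain ⟨F, hF⟩ := hT
  rw [hF.torsion_eq] at hX ⊢
  intro Z g hg
  rw [← cancel_epi f, comp_zero]
  exact hX _ hg

/-- The sum of all subobjects of `M` in `T` again lies in `T`, and the quotient by it is
torsion-free: the preimage of a subobject in `T` is an extension in `T`, hence already in the sum.
-/
lemma isTorsionClass_of_closure [WellPowered.{v} C] [HasCoproducts.{v} C]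
    {T : ObjectProperty C} (hquot : ∀ {X Y : C} (f : X ⟶ Y) [Epi f], T X → T Y)
    (hext : ∀ S : ShortComplex C, S.ShortExact → T S.X₁ → T S.X₃ → T S.X₂)
    (hcoprod : ∀ (I : Type v) (X : I → C), (∀ i, T (X i)) → T (∐ X)) : IsTorsionClass T := by
  refine ⟨T.rightOrthogonal, rfl, le_antisymm (fun X hX Y f hY => hY f hX) fun M hM => ?_⟩
  let e := equivShrink.{v} (Subobject M)
  let I := {A : Shrink.{v} (Subobject M) // T (Subobject.underlying.obj (e.symm A))}
  let p : (∐ fun i : I => Subobject.underlying.obj (e.symm i.1)) ⟶ M :=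
    Sigma.desc fun i => (e.symm i.1).arrow
  have hsub : ∀ B : Subobject M, T (Subobject.underlying.obj B) →
      B.arrow ≫ cokernel.π (Limits.image.ι p) = 0 := by
    intro B hB
    obtain ⟨b, rfl⟩ := e.symm.surjective B
    let i : I := ⟨b, hB⟩
    have h : (Sigma.ι (fun i : I => Subobject.underlying.obj (e.symm i.1)) i ≫
        factorThruImage p) ≫ Limits.image.ι p = (e.symm i.1).arrow := by
      rw [Category.assoc, Limits.image.fac]
      exact Sigma.ι_desc _ _
    rw [← h, Category.assoc, cokernel.condition, comp_zero]
  have hle : ∀ {A : C} (m : A ⟶ M) [Mono m], T A → m ≫ cokernel.π (Limits.image.ι p) = 0 := by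
    intro A m _ hA
    rw [← Subobject.underlyingIso_arrow m, Category.assoc,
      hsub _ (hquot (Subobject.underlyingIso m).inv hA), comp_zero]
  have hfree : T.rightOrthogonal (cokernel (Limits.image.ι p)) := by
    intro X f hX
    have hS := shortExact_pullback (shortExact_cokernel (Limits.image.ι p)) (Limits.image.ι f)
    have h := hle (pullback.fst (cokernel.π (Limits.image.ι p)) (Limits.image.ι f)) (hext _ hS
      (hquot (Limits.factorThruImage p) (hcoprod _ _ fun i => i.2)) (hquot (Limits.factorThruImage f) hX))
    have := hS.epi_g
    rw [pullback.condition, ← comp_zero (f := pullback.snd _ _), cancel_epi] at h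
    rw [← Limits.image.fac f, h, comp_zero]
  have h0 : cokernel.π (Limits.image.ι p) = 0 := hM _ hfree
  have : Epi (Limits.image.ι p) := Preadditive.epi_of_cokernel_zero h0
  exact hquot (Limits.factorThruImage p ≫ Limits.image.ι p) (hcoprod _ _ fun i => i.2)

lemma classProjectiveDimension_le_one_iff (P : ObjectProperty C) :
    classProjectiveDimension P ≤ 1 ↔ ∀ X, P X → HasProjectiveDimensionLE X 1 := by
  simp only [classProjectiveDimension, iSup_le_iff]
  exact forall₂_congr fun X _ => projectiveDimension_le_iff X 1

end

/-! ### Objects of type `FP_n` and `FP_n`-injectives -/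

section

variable {C : Type u} [Category.{v} C] [Abelian C] [IsGrothendieckAbelian.{v} C]

lemma isFP.preservesFilteredColimits {n : ℕ} (hn : 1 ≤ n) {F : C} (hF : isFP n F) :
    PreservesFilteredColimitsOfSize.{v, v} (extFunctorObj.{v} F 0) := by
  obtain ⟨m, rfl⟩ := Nat.exists_eq_succ_of_ne_zero (by lia : n ≠ 0)
  exact hF 0 (Nat.zero_le m)

instance hasExactColimitsOfShape_nat : HasExactColimitsOfShape ℕ C :=
  have : AB5OfSize.{0, 0} C := AB5OfSize_shrink.{0, 0, v, v} C
  inferInstance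

lemma isFP.preservesColimitsOfShape_nat {n : ℕ} (hn : 1 ≤ n) {F : C} (hF : isFP n F) :
    PreservesColimitsOfShape ℕ (extFunctorObj.{v} F 0) :=
  have := hF.preservesFilteredColimits hn
  have : PreservesFilteredColimitsOfSize.{0, 0} (extFunctorObj.{v} F 0) :=
    preservesFilteredColimitsOfSize_of_univLE.{v, v} _
  inferInstance

lemma isFP.isFinitelyPresentable {n : ℕ} (hn : 1 ≤ n) {F : C} (hF : isFP n F) :
    IsFinitelyPresentable.{v} F := by
  rw [isFinitelyPresentable_iff_preservesFilteredColimits]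
  have := hF.preservesFilteredColimits hn
  have := comp_preservesFilteredColimits (extFunctorObj.{v} F 0) (forget AddCommGrpCat.{v})
  let e : extFunctorObj.{v} F 0 ⋙ forget AddCommGrpCat.{v} ≅ coyoneda.obj (Opposite.op F) :=
    NatIso.ofComponents (fun X => Ext.homEquiv₀.toIso) fun {X Y} f => by
      ext x
      obtain ⟨g, rfl⟩ := (Ext.mk₀_bijective _ _).2 x
      change Ext.homEquiv₀ ((Ext.mk₀ g).comp (Ext.mk₀ f) (add_zero 0)) =
        Ext.homEquiv₀ (Ext.mk₀ g) ≫ f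
      apply Ext.homEquiv₀.symm.injective
      simp [Ext.homEquiv₀]
  exact ⟨fun J _ _ => preservesColimitsOfShape_of_natIso e⟩

/-- The generators are finitely presentable, so `C` is locally finitely presentable and its finitely
presentable objects, among them those of type `FP_n`, are essentially small. -/
lemma exists_small_isFP {n : ℕ} (hn : 1 ≤ n) (hC : IsLocallyTypeFP C n) :
    ∃ (A : Type v) (F : A → C), (∀ a, isFP n (F a)) ∧ ∀ X : C, isFP n X →
      ∃ a, Nonempty (X ≅ F a) := by
  obtain ⟨I, G, hG, hGn⟩ := hC
  let := Cardinal.fact_isRegular_aleph0.{v}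
  have : IsCardinalLocallyPresentable C Cardinal.aleph0.{v} := by
    rw [IsCardinalLocallyPresentable.iff_exists_isStrongGenerator]
    refine ⟨ObjectProperty.ofObj G, inferInstance,
      ObjectProperty.isStrongGenerator_iff.2 ⟨hG, fun X Y i _ h => ?_⟩, ?_⟩
    · refine hG.isDetecting _ fun Z hZ g => ?_
      obtain ⟨f, hf⟩ := h Z hZ g
      exact ⟨f, hf, fun f' hf' => (cancel_mono i).1 (Eq.trans hf' hf.symm)⟩
    · rintro _ ⟨i⟩
      exact (hGn i).isFinitelyPresentable hn
  have hle : (isFP n : ObjectProperty C) ≤ isCardinalPresentable C Cardinal.aleph0.{v} :=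
    fun X hX => hX.isFinitelyPresentable hn
  have : ObjectProperty.EssentiallySmall.{v} (isFP n : ObjectProperty C) :=
    .of_le hle
  obtain ⟨Q, hQ, hQle, hleQ⟩ := ObjectProperty.EssentiallySmall.exists_small_le.{v}
    (isFP n : ObjectProperty C)
  refine ⟨Shrink.{v} (Subtype Q), fun a => ((equivShrink _).symm a).1,
    fun a => hQle _ ((equivShrink _).symm a).2, fun X hX => ?_⟩
  obtain ⟨Y, hY, ⟨e⟩⟩ := hleQ _ hX
  exact ⟨equivShrink _ ⟨Y, hY⟩, ⟨e ≪≫ eqToIso (by simp)⟩⟩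

section

open CoproductsFromFiniteFiltered

/-- The finite subcoproducts form a filtered diagram embedded in one constant injective `P`. Each of
them is `FP_n`-injective, so lifts exist without changing the stage. -/
lemma fpInjective_coproduct {n : ℕ} (hn : 1 ≤ n) {I : Type v} (M : I → C)
    (hM : ∀ i, fpInjective n (M i)) : fpInjective n (∐ M) := by
  intro F hF
  classical
  let P : C := ∏ᶜ fun i => Injective.under (M i)
  let m : ∐ M ⟶ P := Pi.lift fun i => Sigma.π M i ≫ Injective.ι (M i)
  let α : liftToFinsetObj (Discrete.functor M) ⟶ (Functor.const (Finset (Discrete I))).obj P :=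
    (finiteSubcoproductsCocone M).ι ≫ (Functor.const _).map m
  have : ∀ s, Mono (α.app s) := fun s => by
    refine Preadditive.mono_of_cancel_zero _ fun {Z} x hx =>
      eq_zero_of_comp_sigma_π (fun i : s => M i.1.as) x fun i => ?_
    have hi : α.app s ≫ Pi.π _ i.1.as =
        Sigma.π (fun i : s => M i.1.as) i ≫ Injective.ι (M i.1.as) := by
      refine Sigma.hom_ext _ _ fun j => ?_
      dsimp only [α, m, NatTrans.comp_app, Functor.const_map_app, finiteSubcoproductsCocone_ι_app]
      erw [Category.assoc, Pi.lift_π, Sigma.ι_desc_assoc]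
      by_cases hij : j = i
      · subst hij
        erw [Sigma.ι_π_eq_id_assoc, Sigma.ι_π_eq_id_assoc]
      · erw [Sigma.ι_π_of_ne_assoc _ hij, Sigma.ι_π_of_ne_assoc]
        exact fun h => hij (Subtype.ext (Discrete.ext h))
    refine (cancel_mono (Injective.ι (M i.1.as))).1
      ((Category.assoc _ _ _).trans ((congrArg (x ≫ ·) hi.symm).trans ?_))
    rw [reassoc_of% hx, zero_comp, zero_comp]
  have : Mono α := NatTrans.mono_of_mono_app α
  have := hF.preservesFilteredColimits hn
  refine subsingleton_ext_colimit (shortExact_cokernel α)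
    (isColimitFiniteSubproductsCocone M) (isColimitConstCocone _ P) ?_ fun s f => ?_
  · exact Ext.subsingleton_of_injective _ P _
  · have hS := (shortExact_cokernel α).map_of_exact ((evaluation _ _).obj s)
    obtain ⟨g, hg⟩ := exists_lift_of_subsingleton_ext hS
      (subsingleton_ext_finite_coproduct _ fun i => hM _ F hF) f
    exact ⟨s, 𝟙 s, g, by rw [CategoryTheory.Functor.map_id, Category.comp_id]; exact hg⟩

end

lemma fpInjective_extension {n : ℕ} {S : ShortComplex C} (hS : S.ShortExact)
    (h₁ : fpInjective n S.X₁) (h₃ : fpInjective n S.X₃) : fpInjective n S.X₂ :=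
  fun F hF => subsingleton_ext_extension_right hS (h₁ F hF) (h₃ F hF)

lemma fpInjective_of_injective (n : ℕ) (M : C) [Injective M] : fpInjective n M :=
  fun _ _ => Ext.subsingleton_of_injective _ _ _

lemma fpInjective_of_epi {n : ℕ} (h : classProjectiveDimension (isFP n : ObjectProperty C) ≤ 1)
    {X Y : C} (f : X ⟶ Y) [Epi f] (hX : fpInjective n X) : fpInjective n Y := fun F hF =>
  have := (classProjectiveDimension_le_one_iff _).1 h F hF
  subsingleton_ext_quotient (shortExact_kernel f) (hX F hF)
    (HasProjectiveDimensionLT.subsingleton F 2 2 le_rfl _)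

lemma classProjectiveDimension_le_one_of_epi {n : ℕ}
    (h : ∀ {X Y : C} (f : X ⟶ Y) [Epi f], fpInjective n X → fpInjective n Y) :
    classProjectiveDimension (isFP n : ObjectProperty C) ≤ 1 := by
  refine (classProjectiveDimension_le_one_iff _).2 fun F hF =>
    hasProjectiveDimensionLT_of_enoughInjectives F 2 fun M => ?_
  exact subsingleton_ext_succ (shortExact_cokernel (Injective.ι M))
    (h (cokernel.π (Injective.ι M)) (fpInjective_of_injective n _) F hF)
    (Ext.subsingleton_of_injective _ _ _)

lemma isTorsionClass_fpInjective {n : ℕ} (hn : 1 ≤ n)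
    (h : classProjectiveDimension (isFP n : ObjectProperty C) ≤ 1) :
    IsTorsionClass (fpInjective n : ObjectProperty C) :=
  isTorsionClass_of_closure (fpInjective_of_epi h) (fun _ => fpInjective_extension)
    fun _ => fpInjective_coproduct hn

lemma gen_of_epi {T X Y : C} (f : X ⟶ Y) [Epi f] : gen T X → gen T Y :=
  fun ⟨I, g, _⟩ => ⟨I, g ≫ f, inferInstance⟩

end

/-! ### Countable chains -/

section

variable {C : Type u} [Category.{v} C]

lemma exists_desc_of_chain {X : ℕ ⥤ C} {c : Cocone X} (hc : IsColimit c) {J Q : C} (q : J ⟶ Q)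
    (f : c.pt ⟶ Q) (l₀ : X.obj 0 ⟶ J) (h₀ : l₀ ≫ q = c.ι.app 0 ≫ f)
    (step : ∀ (k : ℕ) (l : X.obj k ⟶ J), l ≫ q = c.ι.app k ≫ f →
      ∃ l' : X.obj (k + 1) ⟶ J, X.map (homOfLE (k.le_add_right 1)) ≫ l' = l ∧
        l' ≫ q = c.ι.app (k + 1) ≫ f) :
    ∃ L : c.pt ⟶ J, c.ι.app 0 ≫ L = l₀ ∧ L ≫ q = f := by
  choose next hnext hnextq using step
  let s : ∀ k, {l : X.obj k ⟶ J // l ≫ q = c.ι.app k ≫ f} := fun k =>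
    Nat.rec ⟨l₀, h₀⟩ (fun k l => ⟨next k l.1 l.2, hnextq k l.1 l.2⟩) k
  let d : Cocone X := ⟨J, NatTrans.ofSequence (fun k => (s k).1) fun k => by
    simpa using hnext k (s k).1 (s k).2⟩
  refine ⟨hc.desc d, hc.fac d 0, hc.hom_ext fun k => ?_⟩
  rw [hc.fac_assoc]
  exact (s k).2

end

section

variable {C : Type u} [Category.{v} C] [Abelian C]

lemma exists_desc_of_injective_chain {X : ℕ ⥤ C} {c : Cocone X} (hc : IsColimit c)
    (hX : ∀ k : ℕ, Mono (X.map (homOfLE (k.le_add_right 1)))) {J : C} [Injective J]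
    (f : X.obj 0 ⟶ J) : ∃ g : c.pt ⟶ J, c.ι.app 0 ≫ g = f := by
  obtain ⟨g, hg, -⟩ := exists_desc_of_chain hc (0 : J ⟶ J) 0 f (by simp) fun k l _ =>
    have := hX k
    ⟨Injective.factorThru l _, Injective.comp_factorThru l _, by simp⟩
  exact ⟨g, hg⟩

lemma mono_of_chain [EnoughInjectives C] {X : ℕ ⥤ C} {c : Cocone X} (hc : IsColimit c)
    (hX : ∀ k : ℕ, Mono (X.map (homOfLE (k.le_add_right 1)))) : Mono (c.ι.app 0) := by
  obtain ⟨g, hg⟩ := exists_desc_of_injective_chain hc hX (Injective.ι (X.obj 0))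
  exact mono_of_mono_fac hg

universe w

/-- Eklof's lemma for a chain of length `ω`: a lift vanishing on `X.obj 0` is built stage by stage.
-/
lemma subsingleton_ext_cokernel_of_chain [HasExt.{w} C] [EnoughInjectives C] {X : ℕ ⥤ C}
    {c : Cocone X} (hc : IsColimit c) {M : C} (hX : ∀ k : ℕ, ∃ (S : C) (p : X.obj (k + 1) ⟶ S)
      (w : X.map (homOfLE (k.le_add_right 1)) ≫ p = 0), (ShortComplex.mk _ p w).ShortExact ∧
        Subsingleton (Ext.{w} S M 1)) :
    Subsingleton (Ext.{w} (cokernel (c.ι.app 0)) M 1) := by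
  have hM' := shortExact_cokernel (Injective.ι M)
  refine subsingleton_ext_of_exists_lift hM' (Ext.subsingleton_of_injective _ _ _) fun f => ?_
  obtain ⟨L, hL, hLf⟩ := exists_desc_of_chain hc (cokernel.π (Injective.ι M))
    (cokernel.π (c.ι.app 0) ≫ f) 0 (by simp) fun k l hl => by
      let e := X.map (homOfLE (k.le_add_right 1))
      obtain ⟨S, p, w, hS, hSM⟩ := hX k
      have : Mono e := hS.mono_f
      let l₂ := Injective.factorThru l e
      have hl₂ : e ≫ l₂ = l := Injective.comp_factorThru l e
      -- `l₂` extends `l` but may fail to lift; its error `d` factors through `S` and is corrected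
      -- using `Ext¹(S, M) = 0`.
      let d : X.obj (k + 1) ⟶ cokernel (Injective.ι M) :=
        l₂ ≫ cokernel.π (Injective.ι M) - c.ι.app (k + 1) ≫ cokernel.π (c.ι.app 0) ≫ f
      have hd : e ≫ d = 0 := by
        rw [Preadditive.comp_sub, reassoc_of% hl₂, hl, sub_eq_zero, c.w_assoc]
      obtain ⟨φ, hφ⟩ : ∃ φ, p ≫ φ = d :=
        ⟨hS.gIsCokernel.desc (CokernelCofork.ofπ d hd),
          hS.gIsCokernel.fac _ WalkingParallelPair.one⟩
      obtain ⟨g, hg⟩ := exists_lift_of_subsingleton_ext hM' hSM φ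
      dsimp at hg
      refine ⟨l₂ - p ≫ g, ?_, ?_⟩
      · rw [Preadditive.comp_sub, reassoc_of% w, zero_comp, sub_zero]
        exact hl₂
      · rw [Preadditive.sub_comp, Category.assoc, hg, hφ, sub_sub_cancel]
  refine ⟨cokernel.desc _ L hL, (cancel_epi (cokernel.π (c.ι.app 0))).1 ?_⟩
  rw [cokernel.π_desc_assoc]
  exact hLf

variable (C) in
/-- An object together with an embedding into an injective object. -/
structure InjectiveEmbedding where
  /-- the embedded object -/
  obj : C
  /-- the ambient injective object -/
  ambient : C
  /-- the embedding -/
  ι : obj ⟶ ambient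
  [mono : Mono ι]
  [injective : Injective ambient]

attribute [instance] InjectiveEmbedding.mono InjectiveEmbedding.injective

/-! ### Universal extensions -/

section

variable [HasCoproducts.{v} C] {A : Type v} (F : A → C)

/-- The coproduct of the objects of a family `F`, indexed by all morphisms from them to `Q`. -/
noncomputable abbrev familySource (Q : C) : C := ∐ fun x : Σ a, F a ⟶ Q => F x.1

/-- The tautological morphism from `familySource F Q` to `Q`. -/
noncomputable abbrev familyMap (Q : C) : familySource F Q ⟶ Q :=
  Limits.Sigma.desc fun x : Σ a, F a ⟶ Q => x.2

variable [EnoughInjectives C]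

/-- Every map from `F a` to the cokernel is a component of `familyMap`, and killing the universal
extension identifies `familyMap`, up to sign, with a map through the new injective summand. -/
lemma exists_lift_familyMap {E J Q Q' : C} {ι : E ⟶ J} {p : J ⟶ Q} {w : ι ≫ p = 0}
    (hp : (ShortComplex.mk ι p w).ShortExact)
    (q : J ⊞ Injective.under (familySource F (cokernel ι)) ⟶ Q')
    (hq : biprod.lift (pullback.fst (cokernel.π ι) (familyMap F (cokernel ι)))
      (pullback.snd _ _ ≫ Injective.ι _) ≫ q = 0)
    (t : Q ⟶ Q') (ht : p ≫ t = biprod.inl ≫ q) {a : A} (f : F a ⟶ Q) :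
    ∃ g : F a ⟶ J ⊞ Injective.under (familySource F (cokernel ι)), g ≫ q = f ≫ t := by
  have : Epi p := hp.epi_g
  obtain ⟨d, hd⟩ : ∃ d : Q ⟶ cokernel ι, p ≫ d = cokernel.π ι :=
    ⟨hp.gIsCokernel.desc (CokernelCofork.ofπ (cokernel.π ι) (cokernel.condition _)),
      hp.gIsCokernel.fac _ WalkingParallelPair.one⟩
  let t' : cokernel ι ⟶ Q' := cokernel.desc ι (p ≫ t) (by rw [reassoc_of% w, zero_comp])
  have hdt : d ≫ t' = t := by
    rw [← cancel_epi p, reassoc_of% hd, cokernel.π_desc]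
  have hkey : familyMap F (cokernel ι) ≫ t' = -(Injective.ι _ ≫ biprod.inr ≫ q) := by
    -- The second projection is epi, as a pullback of `cokernel.π ι`; on the pullback the identity
    -- is `hq`.
    rw [← cancel_epi (pullback.snd (cokernel.π ι) (familyMap F (cokernel ι))),
      ← pullback.condition_assoc, cokernel.π_desc, ht, Preadditive.comp_neg, eq_neg_iff_add_eq_zero,
      ← hq, biprod.lift_eq]
    simp
  refine ⟨-(Sigma.ι (fun x : Σ a, F a ⟶ cokernel ι => F x.1) ⟨a, f ≫ d⟩ ≫
    Injective.ι _ ≫ biprod.inr), ?_⟩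
  rw [Preadditive.neg_comp, Category.assoc, Category.assoc, ← Preadditive.comp_neg, ← hkey,
    Sigma.ι_desc_assoc, Category.assoc, hdt]

namespace InjectiveEmbedding

/-- The universal extension of `X.obj` by objects of the family `F`. -/
noncomputable def universalExtension (X : InjectiveEmbedding C) : InjectiveEmbedding C where
  obj := pullback (cokernel.π X.ι) (familyMap F (cokernel X.ι))
  ambient := X.ambient ⊞ Injective.under (familySource F (cokernel X.ι))
  ι := biprod.lift (pullback.fst _ _) (pullback.snd _ _ ≫ Injective.ι _)
  mono := Preadditive.mono_of_cancel_zero _ fun g hg => by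
    have h₁ := congrArg (· ≫ biprod.fst) hg
    have h₂ := congrArg (· ≫ biprod.snd) hg
    simp only [Category.assoc, biprod.lift_fst, biprod.lift_snd, zero_comp] at h₁ h₂
    refine pullback.hom_ext (by rw [h₁, zero_comp]) ?_
    rw [← cancel_mono (Injective.ι _), Category.assoc, h₂, zero_comp, zero_comp]

/-- The inclusion of `X.obj` in its universal extension. -/
noncomputable def toUniversalExtension (X : InjectiveEmbedding C) :
    X.obj ⟶ (X.universalExtension F).obj :=
  pullback.lift X.ι 0 (by rw [cokernel.condition, zero_comp])

lemma shortExact_universalExtension (X : InjectiveEmbedding C) :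
    (ShortComplex.mk (X.toUniversalExtension F)
      (pullback.snd (cokernel.π X.ι) (familyMap F (cokernel X.ι)))
      (pullback.lift_snd _ _ _)).ShortExact :=
  shortExact_pullback (shortExact_cokernel X.ι) _

instance (X : InjectiveEmbedding C) : Mono (X.toUniversalExtension F) :=
  (X.shortExact_universalExtension F).mono_f

lemma toUniversalExtension_ι (X : InjectiveEmbedding C) :
    X.toUniversalExtension F ≫ (X.universalExtension F).ι = X.ι ≫ biprod.inl := by
  change pullback.lift (f := cokernel.π X.ι) (g := familyMap F (cokernel X.ι)) X.ι 0 _ ≫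
    biprod.lift (pullback.fst _ _) (pullback.snd _ _ ≫ Injective.ι (familySource F _)) =
      X.ι ≫ biprod.inl
  refine biprod.hom_ext _ _ ?_ ?_
  · simp only [Category.assoc, biprod.lift_fst, pullback.lift_fst, biprod.inl_fst,
      Category.comp_id]
  · simp only [Category.assoc, biprod.lift_snd, pullback.lift_snd_assoc, zero_comp,
      biprod.inl_snd, comp_zero]

/-- The iterated universal extensions of `X.obj` by objects of the family `F`. -/
noncomputable def iterate (X : InjectiveEmbedding C) : ℕ → InjectiveEmbedding C
  | 0 => X
  | k + 1 => (X.iterate k).universalExtension F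

/-- The chain of iterated universal extensions of `X.obj`. -/
noncomputable def chain (X : InjectiveEmbedding C) : ℕ ⥤ C :=
  Functor.ofSequence (X := fun k => (X.iterate F k).obj)
    fun k => (X.iterate F k).toUniversalExtension F

/-- The chain of the ambient injective objects of the iterated universal extensions. -/
noncomputable def ambientChain (X : InjectiveEmbedding C) : ℕ ⥤ C :=
  Functor.ofSequence (X := fun k => (X.iterate F k).ambient) fun _ => biprod.inl

lemma chain_map_succ (X : InjectiveEmbedding C) (k : ℕ) :
    (X.chain F).map (homOfLE (k.le_add_right 1)) = (X.iterate F k).toUniversalExtension F :=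
  Functor.ofSequence_map_homOfLE_succ _ _

lemma ambientChain_map_succ (X : InjectiveEmbedding C) (k : ℕ) :
    (X.ambientChain F).map (homOfLE (k.le_add_right 1)) =
      (biprod.inl : (X.iterate F k).ambient ⟶ _) :=
  Functor.ofSequence_map_homOfLE_succ _ _

/-- The embedding of the chain of iterated universal extensions in the chain of ambient injective
objects. -/
noncomputable def chainι (X : InjectiveEmbedding C) : X.chain F ⟶ X.ambientChain F :=
  NatTrans.ofSequence (fun k => (X.iterate F k).ι) fun k =>
    (congrArg (· ≫ _) (X.chain_map_succ F k)).trans ((toUniversalExtension_ι F _).trans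
      (congrArg (_ ≫ ·) (X.ambientChain_map_succ F k).symm))

instance (X : InjectiveEmbedding C) : Mono (X.chainι F) :=
  have : ∀ k, Mono ((X.chainι F).app k) := fun k => (X.iterate F k).mono
  NatTrans.mono_of_mono_app _

instance (X : InjectiveEmbedding C) (k : ℕ) :
    Mono ((X.chain F).map (homOfLE (k.le_add_right 1))) := by
  rw [chain_map_succ]
  exact (shortExact_universalExtension F (X.iterate F k)).mono_f

lemma exists_shortExact_chain_map (X : InjectiveEmbedding C) (k : ℕ) :
    ∃ (Q : C) (p : (X.chain F).obj (k + 1) ⟶ familySource F Q)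
      (w : (X.chain F).map (homOfLE (k.le_add_right 1)) ≫ p = 0),
      (ShortComplex.mk _ p w).ShortExact := by
  rw [chain_map_succ]
  exact ⟨_, _, _, shortExact_universalExtension F (X.iterate F k)⟩

end InjectiveEmbedding

end

end

/-! ### Special preenvelopes and the tilting object -/

section

variable {C : Type u} [Category.{v} C] [Abelian C] [IsGrothendieckAbelian.{v} C]

lemma fpInjective_colimit_nat {n : ℕ} (hn : 1 ≤ n)
    (h : classProjectiveDimension (isFP n : ObjectProperty C) ≤ 1) {X : ℕ ⥤ C} {c : Cocone X}
    (hc : IsColimit c) (hX : ∀ k, fpInjective n (X.obj k)) : fpInjective n c.pt := by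
  let p : (∐ fun k : ULift.{v} ℕ => X.obj k.down) ⟶ c.pt :=
    Limits.Sigma.desc fun k => c.ι.app k.down
  have : Epi p := ⟨fun g₁ g₂ hg => hc.hom_ext fun k => by
    simpa [p] using congrArg (Sigma.ι (fun k : ULift.{v} ℕ => X.obj k.down) ⟨k⟩ ≫ ·) hg⟩
  exact fpInjective_of_epi h p (fpInjective_coproduct hn _ fun k => hX k.down)

theorem exists_special_fpInjective_preenvelope {n : ℕ} (hn : 1 ≤ n) (hC : IsHereditaryFP C n)
    (G : C) :
    ∃ (T : C) (i : G ⟶ T), Mono i ∧ (∀ M : C, fpInjective n M → Subsingleton (Ext.{v} (cokernel i) M 1)) ∧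
      fpInjective n T := by
  obtain ⟨A, F, hF, hFA⟩ := exists_small_isFP hn hC.locallyTypeFP
  let X : InjectiveEmbedding C := ⟨G, _, Injective.ι G⟩
  let c := colimit.cocone (X.chain F)
  have hc : IsColimit c := colimit.isColimit _
  refine ⟨c.pt, c.ι.app 0, mono_of_chain hc inferInstance, fun M hM =>
    subsingleton_ext_cokernel_of_chain hc fun k => ?_, fun Y hY => ?_⟩
  · obtain ⟨Q, p, w, hS⟩ := X.exists_shortExact_chain_map F k
    exact ⟨_, p, w, hS, subsingleton_ext_coproduct _ fun x => hM _ (hF x.1)⟩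
  have := hY.preservesColimitsOfShape_nat hn
  have := preservesFilteredColimitsOfSize_of_univLE.{v, v, 0, 0} (forget AddCommGrpCat.{v})
  have hQ := shortExact_cokernel (X.chainι F)
  refine subsingleton_ext_colimit hQ hc (colimit.isColimit (X.ambientChain F))
    -- The colimit of the ambient injectives is only known to be `FP_n`-injective, which suffices;
    -- this uses `pd ≤ 1`.
    (fpInjective_colimit_nat hn hC.pd_le_one (colimit.isColimit _) (fun k =>
      have : Injective ((X.ambientChain F).obj k) := (X.iterate F k).injective
      fpInjective_of_injective n _) Y hY) fun k f => ?_
  obtain ⟨a, ⟨e⟩⟩ := hFA Y hY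
  obtain ⟨g, hg⟩ := exists_lift_familyMap F
    (hQ.map_of_exact ((evaluation _ _).obj k)) ((cokernel.π (X.chainι F)).app (k + 1))
    (NatTrans.congr_app (cokernel.condition (X.chainι F)) (k + 1))
    ((cokernel (X.chainι F)).map (homOfLE (k.le_add_right 1))) (by
      refine Eq.trans ((cokernel.π (X.chainι F)).naturality _).symm ?_
      rw [X.ambientChain_map_succ F]
      rfl) (e.inv ≫ f)
  exact ⟨k + 1, homOfLE (k.le_add_right 1), e.hom ≫ g, by
    refine (Category.assoc _ _ _).trans ((congrArg (e.hom ≫ ·) hg).trans ?_)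
    simp⟩

/-- `Gen`, the `FP_n`-injectives and the `Ext¹`-orthogonal of `T ⊞ cokernel i` coincide by a cycle
of three inclusions. -/
theorem IsHereditaryFP.isOneTiltingClass {n : ℕ} (hn : 1 ≤ n) (hC : IsHereditaryFP C n) :
    IsOneTiltingClass (fpInjective n : ObjectProperty C) := by
  obtain ⟨I, G, hG, hGn⟩ := hC.locallyTypeFP
  obtain ⟨T, i, _, hi, hT⟩ := exists_special_fpInjective_preenvelope hn hC (∐ G)
  have hquot := fun {X Y : C} => fpInjective_of_epi (X := X) (Y := Y) hC.pd_le_one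
  have hbiprod := (ShortComplex.Splitting.ofHasBinaryBiproduct T (cokernel i)).shortExact
  have hgen : gen (T ⊞ cokernel i) ≤ fpInjective n := by
    rintro M ⟨J, f, _⟩
    exact hquot f (fpInjective_coproduct hn _ fun _ =>
      fpInjective_extension hbiprod hT (hquot (cokernel.π i) hT))
  have hperp : fpInjective n ≤ rightExtOrthogonal (ObjectProperty.singleton (T ⊞ cokernel i)) := by
    rintro M hM _ ⟨⟩
    exact subsingleton_ext_extension_left hbiprod (subsingleton_ext_extension_left
      (shortExact_cokernel i) (subsingleton_ext_coproduct G fun a => hM _ (hGn a)) (hi M hM))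
      (hi M hM)
  have htilt : rightExtOrthogonal (ObjectProperty.singleton (T ⊞ cokernel i)) ≤
      gen (T ⊞ cokernel i) := by
    intro M hM
    have hM' : Subsingleton (Ext.{v} (cokernel i) M 1) := by
      have := hM (T ⊞ cokernel i) (by simp)
      refine subsingleton_of_forall_eq 0 fun x => ?_
      rw [← x.mk₀_id_comp, ← biprod.inr_snd (X := T), ← Ext.mk₀_comp_mk₀,
        Ext.comp_assoc_of_second_deg_zero,
        Subsingleton.elim ((Ext.mk₀ biprod.snd).comp x (zero_add 1)) 0, Ext.comp_zero]
    choose g hg using fun f : ∐ G ⟶ M =>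
      exists_extension_of_subsingleton_ext (shortExact_cokernel i) hM' f
    -- One copy for each map from the generator to `M`: each extends to `T`, so their joint map is
    -- epi.
    refine ⟨∐ G ⟶ M, Limits.Sigma.desc fun f => biprod.fst ≫ g f, ⟨fun {Z} a b hab => ?_⟩⟩
    refine ((isSeparator_sigma G).2 hG).def _ _ fun f => ?_
    have h := congrArg (biprod.inl ≫ Sigma.ι (fun _ : ∐ G ⟶ M => T ⊞ cokernel i) f ≫ ·) hab
    simp only [Sigma.ι_desc_assoc, Category.assoc, biprod.inl_fst_assoc] at h
    rw [← hg f, Category.assoc, Category.assoc]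
    exact congrArg (i ≫ ·) h
  exact ⟨T ⊞ cokernel i, le_antisymm (hgen.trans hperp) htilt,
    le_antisymm (hperp.trans htilt) hgen⟩

end

end GrothendieckFP

theorem mainTheorem6 {C : Type u} [Category.{v} C] [Abelian C] [IsGrothendieckAbelian.{v} C]
    (n : ℕ) (hn : 1 ≤ n) :
    [GrothendieckFP.IsHereditaryFP C n,
      GrothendieckFP.IsLocallyTypeFP C n ∧
        GrothendieckFP.IsTorsionClass (GrothendieckFP.fpInjective n : ObjectProperty C),
      GrothendieckFP.IsLocallyTypeFP C n ∧
        GrothendieckFP.IsOneTiltingClass (GrothendieckFP.fpInjective n : ObjectProperty C)].TFAE := by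
  tfae_have 1 → 2 := fun h =>
    ⟨h.locallyTypeFP, GrothendieckFP.isTorsionClass_fpInjective hn h.pd_le_one⟩
  tfae_have 2 → 1 := fun h =>
    ⟨h.1, GrothendieckFP.classProjectiveDimension_le_one_of_epi fun f _ => h.2.of_epi f⟩
  tfae_have 1 → 3 := fun h => ⟨h.locallyTypeFP, h.isOneTiltingClass hn⟩
  tfae_have 3 → 1 := by
    rintro ⟨hC, T, -, hT⟩
    refine ⟨hC, GrothendieckFP.classProjectiveDimension_le_one_of_epi fun f _ => ?_⟩
    rw [hT]
    exact GrothendieckFP.gen_of_epi f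
  tfae_finish
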